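/- For $n\ge 1$ let $\mathcal S_n^B$ be the hyperoctahedral group of rank $n$, i.e. the group of permutations $\pi$ of $\{\pm1,\dots,\pm n\}$ with $\pi(-i)=-\pi(i)$ for all $i$. Put $\mathrm{des}_A(\pi)=\#\{1\le i\le n-1:\pi(i)>\pi(i+1)\}$, let $\mathrm{fdes}(\pi)=2\,\mathrm{des}_A(\pi)+1$ if $\pi(1)<0$ and $\mathrm{fdes}(\pi)=2\,\mathrm{des}_A(\pi)$ otherwise, and let $C_n(x)=\sum_{\pi\in\mathcal S_n^B}x^{\mathrm{fdes}(\pi)}$ be the flag descent polynomial. Set $$C_n^E(x)=\sum_{\pi\in\mathcal S_n^B,\ \pi(1)>0}x^{\mathrm{des}_A(\pi)},\qquad C_n^O(x)=\sum_{\pi\in\mathcal S_n^B,\ \pi(1)<0}x^{\mathrm{des}_A(\pi)}.$$ For real polynomials $p,q$ with only real zeros, $\xi_1\le\dots\le\xi_k$ those of $p$ and $\theta_1\le\dots\le\theta_m$ those of $q$ (with multiplicity), write $p\prec q$ if either $m=k+1$ and $\theta_1\le\xi_1\le\theta_2\le\dots\le\xi_k\le\theta_{k+1}$, or $m=k$ and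 $\xi_1\le\theta_1\le\xi_2\le\dots\le\xi_k\le\theta_k$. Then $C_1^E(x)=C_1^O(x)=1$, and for every $n\ge1$ the polynomials $C_n^E$ and $C_n^O$ are the even and odd parts of $C_n$, that is, $C_n(x)=C_n^E(x^2)+xC_n^O(x^2)$, and $$\begin{aligned}C_{n+1}^E(x)&=(2nx+1)\,C_n^E(x)+2x(1-x)\,\frac{d}{dx}C_n^E(x)+x\,C_n^O(x),\\ C_{n+1}^O(x)&=\bigl((2n-1)x+2\bigr)C_n^O(x)+2x(1-x)\,\frac{d}{dx}C_n^O(x)+C_n^E(x).\end{aligned}$$ Moreover, for every $n\ge 1$, both $C_n^E(x)$ and $C_n^O(x)$ have only real negative zeros, and $C_n^O(x)\prec C_n^E(x)$. -/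

import Mathlib

open Polynomial

namespace FlagDescent

/-- The set `±[n] = {±1, ±2, …, ±n}`. -/
abbrev PM (n : ℕ) : Type := {i : ℤ // i ∈ (Finset.Icc (-(n : ℤ)) (n : ℤ)).erase 0}

/-- The involution `i ↦ -i` of `±[n]`. -/
def PM.neg {n : ℕ} (i : PM n) : PM n :=
  ⟨-i.1, by
    have h := i.2
    simp only [Finset.mem_erase, Finset.mem_Icc, ne_eq] at h ⊢
    omega⟩

/-- The hyperoctahedral group of rank `n`: all permutations `π` of `±[n]` such that
`π (-i) = - π i` for all `i`, under composition. -/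
def hyperoctahedral (n : ℕ) : Subgroup (Equiv.Perm (PM n)) where
  carrier := {π | ∀ i, π i.neg = (π i).neg}
  mul_mem' := by
    intro a b ha hb i
    change a (b i.neg) = (a (b i)).neg
    rw [hb i, ha (b i)]
  one_mem' := fun _ => rfl
  inv_mem' := by
    intro a ha i
    apply a.injective
    rw [ha (a⁻¹ i)]
    simp

noncomputable instance (n : ℕ) : DecidablePred (fun π : Equiv.Perm (PM n) => π ∈ hyperoctahedral n) :=
  fun π => inferInstanceAs (Decidable (∀ i, π i.neg = (π i).neg))

/-- The value `π(i) ∈ ℤ` for `i ∈ ±[n]` (and `0` for the integers `i` outside `±[n]`). -/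
noncomputable def value {n : ℕ} (π : hyperoctahedral n) (i : ℤ) : ℤ :=
  if h : i ∈ (Finset.Icc (-(n : ℤ)) (n : ℤ)).erase 0 then ((π : Equiv.Perm (PM n)) ⟨i, h⟩ : ℤ)
  else 0

/-- `des_A(π)`, the number of `i ∈ {1, …, n - 1}` with `π(i) > π(i+1)`. -/
noncomputable def desA {n : ℕ} (π : hyperoctahedral n) : ℕ :=
  ((Finset.Icc (1 : ℤ) ((n : ℤ) - 1)).filter (fun i => value π (i + 1) < value π i)).card

/-- The flag descent number of `π`. -/
noncomputable def fdes {n : ℕ} (π : hyperoctahedral n) : ℕ :=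
  if value π 1 < 0 then 2 * desA π + 1 else 2 * desA π

/-- The flag descent polynomial `C_n(x)`. -/
noncomputable def flagDescentPoly (n : ℕ) : ℝ[X] :=
  ∑ π : hyperoctahedral n, X ^ fdes π

/-- `C_n^E(x)`, the sum of `x ^ des_A(π)` over the `π` with `π(1) > 0`. -/
noncomputable def CE (n : ℕ) : ℝ[X] :=
  ∑ π : hyperoctahedral n with 0 < value π 1, X ^ desA π

/-- `C_n^O(x)`, the sum of `x ^ des_A(π)` over the `π` with `π(1) < 0`. -/
noncomputable def CO (n : ℕ) : ℝ[X] :=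
  ∑ π : hyperoctahedral n with value π 1 < 0, X ^ desA π

/-- All complex zeros of `p` are real and negative. -/
def OnlyRealNegativeZeros (p : ℝ[X]) : Prop :=
  ∀ z : ℂ, aeval z p = 0 → ∃ r : ℝ, r < 0 ∧ z = (r : ℂ)

/-- `p` is a nonzero polynomial of degree `n` with only real zeros, and these are
`ξ 0 ≤ ξ 1 ≤ … ≤ ξ (n - 1)`, listed with multiplicity. -/
def HasZeros {n : ℕ} (p : ℝ[X]) (ξ : Fin n → ℝ) : Prop :=
  p ≠ 0 ∧ Monotone ξ ∧ p = C p.leadingCoeff * ∏ i, (X - C (ξ i))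

/-- `p` interlaces `q`: `deg q = 1 + deg p` and `θ₁ ≤ ξ₁ ≤ θ₂ ≤ ⋯ ≤ ξₙ ≤ θₙ₊₁`, where the `ξᵢ` are
the zeros of `p` and the `θᵢ` those of `q`. -/
def Interlaces (p q : ℝ[X]) : Prop :=
  ∃ (n : ℕ) (ξ : Fin n → ℝ) (θ : Fin (n + 1) → ℝ), HasZeros p ξ ∧ HasZeros q θ ∧
    ∀ i : Fin n, θ i.castSucc ≤ ξ i ∧ ξ i ≤ θ i.succ

/-- `p` alternates left of `q`: `deg p = deg q` and `ξ₁ ≤ θ₁ ≤ ξ₂ ≤ ⋯ ≤ ξₙ ≤ θₙ`, where the `ξᵢ` are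
the zeros of `p` and the `θᵢ` those of `q`. -/
def AlternatesLeft (p q : ℝ[X]) : Prop :=
  ∃ (n : ℕ) (ξ θ : Fin n → ℝ), HasZeros p ξ ∧ HasZeros q θ ∧
    (∀ i, ξ i ≤ θ i) ∧ ∀ i j : Fin n, (i : ℕ) + 1 = j → θ i ≤ ξ j

/-- `p ≺ q`. -/
def Prec (p q : ℝ[X]) : Prop :=
  Interlaces p q ∨ AlternatesLeft p q

end FlagDescent

/-! Everything follows from the factorization $C_n(x)=(1+x)^nA_n(x)$, with $A_n$ the Eulerian
polynomial of degree $n-1$ (`flagDescentPoly_eq_eulerian`). Inserting $\pm(n+1)$ into the word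
$\pi(1)\cdots\pi(n)$ gives the recurrences for $C_n^E$ and $C_n^O$. They combine into one recurrence
for $C_n$, which the product also satisfies. Since $A_n$ has only negative zeros
(`eulerian_eq_prod`), so has $C_n$, of degree $2n-1$. Hermite–Biehler (`interlacing_of_even_odd`)
then applies: on the imaginary axis $C_n(iy)=C_n^E(-y^2)+iy\,C_n^O(-y^2)$, and the argument of this
number, a sum of arctangents, runs monotonically from $0$ towards $(2n-1)\pi/2$. Where it meets odd
multiples of $\pi/2$ the even part vanishes, and at positive multiples of $\pi$ the odd part. These
values alternate, and so do the zeros. -/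

namespace FlagDescent

/-! ### Descents of words under insertion of an extreme letter -/

/-- The number of descents of a word. -/
def des : List ℤ → ℕ
  | a :: b :: l => (if b < a then 1 else 0) + des (b :: l)
  | _ => 0

theorem des_map_range (n : ℕ) (f : ℕ → ℤ) :
    des ((List.range (n + 1)).map f) =
      ((Finset.range n).filter (fun i => f (i + 1) < f i)).card := by
  induction n generalizing f with
  | zero => simp [des]
  | succ n ih =>
    have h := ih (fun i => f (i + 1))
    rw [Finset.card_filter] at h ⊢
    rw [Finset.sum_range_succ', ← h, List.range_succ_eq_map, List.range_succ_eq_map]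
    simp only [List.map_cons, des, List.map_map, Function.comp_def, add_comm, zero_add]

/-- Sum over the insertions of a letter larger than all others, except the insertion in front. -/
theorem sum_insert_large (a : ℤ) (b : ℤ) (l : List ℤ) (h : ∀ c ∈ b :: l, c < a) :
    ∑ k ∈ Finset.range (l.length + 1), (X : ℝ[X]) ^ des ((b :: l).insertIdx (k + 1) a) =
      (1 + (des (b :: l) : ℝ[X])) * X ^ des (b :: l) +
        ((l.length : ℝ[X]) - (des (b :: l) : ℝ[X])) * X ^ (des (b :: l) + 1) := by
  induction l generalizing b with
  | nil =>
    have := h b (by simp)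
    simp [des, this.le]
  | cons c l ih =>
    have hb := h b (by simp)
    have hc := h c (by simp)
    have ih := ih c (fun d hd => h d (by simp at hd ⊢; tauto))
    -- The split-off term puts `a` between `b` and `c`, where it makes exactly one descent whether
    -- or not `b, c` was one. All other insertions keep the pair `b, c` and take place in the tail.
    rw [List.length_cons, Finset.sum_range_succ']
    simp only [List.insertIdx_succ_cons, des] at ih ⊢
    simp only [List.insertIdx_zero, des, if_neg hb.not_gt, if_pos hc, pow_add, ← Finset.mul_sum, ih]
    split_ifs <;> push_cast <;> ring

/-- Sum over the insertions of a letter smaller than all others, except the insertion in front. -/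
theorem sum_insert_small (a : ℤ) (b : ℤ) (l : List ℤ) (h : ∀ c ∈ b :: l, a < c) :
    ∑ k ∈ Finset.range (l.length + 1), (X : ℝ[X]) ^ des ((b :: l).insertIdx (k + 1) a) =
      (des (b :: l) : ℝ[X]) * X ^ des (b :: l) +
        ((l.length : ℝ[X]) + 1 - (des (b :: l) : ℝ[X])) * X ^ (des (b :: l) + 1) := by
  induction l generalizing b with
  | nil =>
    have := h b (by simp)
    simp [des, this]
  | cons c l ih =>
    have hb := h b (by simp)
    have hc := h c (by simp)
    have ih := ih c (fun d hd => h d (by simp at hd ⊢; tauto))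
    rw [List.length_cons, Finset.sum_range_succ']
    simp only [List.insertIdx_succ_cons, des] at ih ⊢
    simp only [List.insertIdx_zero, des, if_pos hb, if_neg hc.not_gt, pow_add, ← Finset.mul_sum, ih]
    split_ifs <;> push_cast <;> ring

/-! ### Words of signed permutations -/

/-- The words `π(1) ⋯ π(n)` of the signed permutations, built by inserting `±(n + 1)`. -/
def signedWords : ℕ → Finset (List ℤ)
  | 0 => {[]}
  | n + 1 => ((signedWords n) ×ˢ (Finset.range (n + 1)) ×ˢ {(n + 1 : ℤ), -(n + 1 : ℤ)}).image
      (fun t => t.1.insertIdx t.2.1 t.2.2)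

/-- Deleting the letter of absolute value `n + 1` undoes an insertion. This description, free of the
recursion, is what the words of group elements are compared with. -/
theorem mem_signedWords {n : ℕ} {l : List ℤ} :
    l ∈ signedWords n ↔ (l.map Int.natAbs).Perm (List.range' 1 n) := by
  induction n generalizing l with
  | zero => simp [signedWords]
  | succ n ih =>
    rw [List.range'_concat]
    simp only [signedWords, Finset.mem_image, Finset.mem_product, Finset.mem_range, Prod.exists,
      Finset.mem_insert, Finset.mem_singleton, ih]
    constructor
    · rintro ⟨l, k, a, ⟨hl, hk, ha⟩, rfl⟩
      have hlen : l.length = n := by simpa using hl.length_eq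
      have ha' : a.natAbs = n + 1 := by omega
      refine ((List.perm_insertIdx a l (by omega)).map _).trans ?_
      rw [List.map_cons, ha']
      refine (hl.cons _).trans ?_
      rw [add_comm 1]
      simpa using (List.perm_append_singleton (n + 1) (List.range' 1 n)).symm
    · intro h
      have hm : n + 1 ∈ l.map Int.natAbs := h.mem_iff.2 (by simp [add_comm])
      obtain ⟨a, ha, hna⟩ := List.mem_map.1 hm
      obtain ⟨s, t, rfl⟩ := List.append_of_mem ha
      have h2 : ((s ++ t).map Int.natAbs).Perm (List.range' 1 n) := by
        have h3 := ((List.perm_middle (a := a) (l₁ := s) (l₂ := t)).map Int.natAbs).symm.trans h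
        rw [List.map_cons, hna] at h3
        refine (List.perm_cons (n + 1)).1 (h3.trans ?_)
        rw [add_comm 1]
        simp
      have hlen := h2.length_eq
      simp only [List.length_map, List.length_append, List.length_range'] at hlen
      refine ⟨s ++ t, s.length, a, ⟨h2, by omega, by omega⟩, ?_⟩
      clear * -
      induction s with
      | nil => rfl
      | cons b s ih => simpa using ih

theorem length_of_mem_signedWords {n : ℕ} {l : List ℤ} (h : l ∈ signedWords n) : l.length = n := by
  simpa using (mem_signedWords.1 h).length_eq

theorem natAbs_of_mem_signedWords {n : ℕ} {l : List ℤ} (h : l ∈ signedWords n) {a : ℤ}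
    (ha : a ∈ l) : 1 ≤ a.natAbs ∧ a.natAbs ≤ n := by
  have := (mem_signedWords.1 h).mem_iff.1 (List.mem_map_of_mem ha)
  simp only [List.mem_range'_1] at this
  omega

/-- The inserted letter is the only one violating `p`, so it can be located and removed. The bounds
on `k` and `k'` matter: `insertIdx` beyond the end leaves the list unchanged. -/
theorem insertIdx_inj_of_separates {α : Type*} (p : α → Prop) {a a' : α} (ha : ¬ p a)
    (ha' : ¬ p a') : ∀ {l l' : List α} {k k' : ℕ}, (∀ b ∈ l, p b) → (∀ b ∈ l', p b) →
      k ≤ l.length → k' ≤ l'.length → l.insertIdx k a = l'.insertIdx k' a' →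
      l = l' ∧ k = k' ∧ a = a'
  | l, l', 0, 0, _, _, _, _, h => by simp_all
  | l, b :: l', 0, k' + 1, _, h2, _, _, h => by
    simp only [List.insertIdx_zero, List.insertIdx_succ_cons, List.cons.injEq] at h
    exact absurd (h.1 ▸ h2 b (by simp)) ha
  | b :: l, l', k + 1, 0, h1, _, _, _, h => by
    simp only [List.insertIdx_zero, List.insertIdx_succ_cons, List.cons.injEq] at h
    exact absurd (h.1 ▸ h1 b (by simp)) ha'
  | [], _, k + 1, _, _, _, h, _, _ => by simp at h
  | _, [], _, k' + 1, _, _, _, h, _ => by simp at h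
  | b :: l, b' :: l', k + 1, k' + 1, h1, h2, h3, h4, h => by
    simp only [List.insertIdx_succ_cons, List.cons.injEq] at h
    obtain ⟨rfl, rfl, rfl⟩ := insertIdx_inj_of_separates p ha ha'
      (fun c hc => h1 c (by simp [hc])) (fun c hc => h2 c (by simp [hc]))
      (by simpa using h3) (by simpa using h4) h.2
    simp [h.1]

theorem sum_signedWords_succ {M : Type*} [AddCommMonoid M] (n : ℕ) (f : List ℤ → M) :
    ∑ l ∈ signedWords (n + 1), f l = ∑ l ∈ signedWords n, ∑ k ∈ Finset.range (n + 1),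
      (f (l.insertIdx k (n + 1)) + f (l.insertIdx k (-(n + 1)))) := by
  rw [signedWords, Finset.sum_image, Finset.sum_product]
  · refine Finset.sum_congr rfl fun l _ => ?_
    rw [Finset.sum_product]
    refine Finset.sum_congr rfl fun k _ => ?_
    rw [Finset.sum_pair (by omega)]
  · rintro ⟨l, k, a⟩ h ⟨l', k', a'⟩ h' heq
    simp only [Finset.coe_product, Set.mem_prod, Finset.mem_coe, Finset.mem_range,
      Finset.coe_insert, Finset.coe_singleton,
      Set.mem_insert_iff, Set.mem_singleton_iff] at h h'
    have e1 := length_of_mem_signedWords h.1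
    have e2 := length_of_mem_signedWords h'.1
    dsimp only at e1 e2 heq
    obtain ⟨rfl, rfl, rfl⟩ := insertIdx_inj_of_separates (fun b : ℤ => b.natAbs ≤ n)
      (by omega : ¬ a.natAbs ≤ n) (by omega : ¬ a'.natAbs ≤ n)
      (fun b hb => (natAbs_of_mem_signedWords h.1 hb).2)
      (fun b hb => (natAbs_of_mem_signedWords h'.1 hb).2) (by omega) (by omega) heq
    rfl


/-! ### Eulerian polynomials have only negative zeros -/

theorem exists_pos_prod_of_roots (p : ℝ[X]) (hp : p.Monic)
    (h : ∀ z : ℂ, aeval z p = 0 → ∃ r : ℝ, r < 0 ∧ z = (r : ℂ)) :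
    ∃ s : Multiset ℝ, s.card = p.natDegree ∧ (∀ a ∈ s, 0 < a) ∧
      p = (s.map fun a => X + C a).prod := by
  induction hn : p.natDegree generalizing p with
  | zero => exact ⟨0, by simp, by simp, by simpa using hp.natDegree_eq_zero.1 hn⟩
  | succ n ih =>
    obtain ⟨z, hz⟩ := IsAlgClosed.exists_aeval_eq_zero ℂ p (by
      rw [degree_eq_natDegree hp.ne_zero, hn]; exact_mod_cast n.succ_ne_zero)
    obtain ⟨r, hr, rfl⟩ := h z hz
    have hroot : p.IsRoot r := by
      rw [IsRoot.def]
      have : aeval (r : ℂ) p = ((p.eval r : ℝ) : ℂ) := by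
        simpa using aeval_algebraMap_apply ℂ r p
      rw [this] at hz
      exact_mod_cast hz
    obtain ⟨q, rfl⟩ := dvd_iff_isRoot.2 hroot
    have hq : q.Monic := (monic_X_sub_C r).of_mul_monic_left hp
    have hd : q.natDegree = n := by
      rw [(monic_X_sub_C r).natDegree_mul hq, natDegree_X_sub_C] at hn
      omega
    obtain ⟨s, hs, hpos, rfl⟩ := ih q hq (fun z hz => h z (by simp [hz])) hd
    refine ⟨(-r) ::ₘ s, by simp [hs], ?_, by simp [sub_eq_add_neg]⟩
    intro a ha
    rcases Multiset.mem_cons.1 ha with rfl | ha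
    · linarith
    · exact hpos a ha

/-- The Eulerian polynomial of the symmetric group of rank `k + 1`, by its recurrence. -/
noncomputable def eulerian : ℕ → ℝ[X]
  | 0 => 1
  | k + 1 => (1 + ((k : ℝ[X]) + 1) * X) * eulerian k + X * (1 - X) * derivative (eulerian k)

theorem eval_derivative_prod (s : Multiset ℝ) (z : ℂ) (h : ∀ a ∈ s, z + (a : ℂ) ≠ 0) :
    aeval z (derivative (s.map fun a => X + C a).prod) =
      aeval z (s.map fun a => X + C a).prod * (s.map fun a : ℝ => (z + (a : ℂ))⁻¹).sum := by
  induction s using Multiset.induction with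
  | empty => simp
  | cons a s ih =>
    have ha := h a (by simp)
    have ih := ih (fun b hb => h b (by simp [hb]))
    simp only [Multiset.map_cons, Multiset.prod_cons, derivative_mul, Multiset.sum_cons, map_add,
      map_mul, ih]
    simp
    field_simp

/-- Termwise, $(1+a)/(z+a)=1+(1-z)/(z+a)$. This rewrites $(1-z)p'/p$ through Möbius maps that
exchange the upper and lower half-planes. -/
theorem mobius_sum (s : Multiset ℝ) (z : ℂ) (h : ∀ a ∈ s, z + (a : ℂ) ≠ 0) :
    (s.map fun a : ℝ => (1 + (a : ℂ)) * (z + (a : ℂ))⁻¹).sum =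
      s.card + (1 - z) * (s.map fun a : ℝ => (z + (a : ℂ))⁻¹).sum := by
  induction s using Multiset.induction with
  | empty => simp
  | cons a s ih =>
    have ha := h a (by simp)
    simp only [Multiset.map_cons, Multiset.sum_cons, ih (fun b hb => h b (by simp [hb])),
      Multiset.card_cons]
    push_cast
    field_simp
    ring

theorem im_mul_mobius_sum_nonpos (s : Multiset ℝ) (hs : ∀ a ∈ s, 0 < a) (z : ℂ) :
    z.im * (s.map fun a : ℝ => (1 + (a : ℂ)) * (z + (a : ℂ))⁻¹).sum.im ≤ 0 := by
  induction s using Multiset.induction with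
  | empty => simp
  | cons a s ih =>
    have ha := hs a (by simp)
    have ih := ih (fun b hb => hs b (by simp [hb]))
    have : z.im * ((1 + (a : ℂ)) * (z + (a : ℂ))⁻¹).im ≤ 0 := by
      have e : (1 + (a : ℂ)) = ((1 + a : ℝ) : ℂ) := by push_cast; rfl
      rw [e, Complex.im_ofReal_mul, Complex.inv_im]
      simp only [Complex.add_im, Complex.ofReal_im, add_zero]
      have : z.im * ((1 + a) * (-z.im / Complex.normSq (z + a))) =
        -((1 + a) * (z.im ^ 2 / Complex.normSq (z + a))) := by ring
      rw [this]
      have := Complex.normSq_nonneg (z + a)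
      have : 0 ≤ (1 + a) * (z.im ^ 2 / Complex.normSq (z + a)) := by positivity
      linarith
    simp only [Multiset.map_cons, Multiset.sum_cons, Complex.add_im, mul_add]
    linarith

theorem re_mobius_sum_nonneg (s : Multiset ℝ) (hs : ∀ a ∈ s, 0 < a) (z : ℂ) (hz : 0 ≤ z.re) :
    0 ≤ (s.map fun a : ℝ => (1 + (a : ℂ)) * (z + (a : ℂ))⁻¹).sum.re := by
  induction s using Multiset.induction with
  | empty => simp
  | cons a s ih =>
    have ha := hs a (by simp)
    have ih := ih (fun b hb => hs b (by simp [hb]))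
    have : 0 ≤ ((1 + (a : ℂ)) * (z + (a : ℂ))⁻¹).re := by
      have e : (1 + (a : ℂ)) = ((1 + a : ℝ) : ℂ) := by push_cast; rfl
      rw [e, Complex.re_ofReal_mul, Complex.inv_re]
      simp only [Complex.add_re, Complex.ofReal_re]
      have := Complex.normSq_nonneg (z + a)
      positivity
    simp only [Multiset.map_cons, Multiset.sum_cons, Complex.add_re]
    linarith

/-- Away from the zeros of the product, dividing by it turns the equation into $T=-1-1/z$ with
$T=\sum(1+a)/(z+a)$. The imaginary part of the right side has the sign of $\operatorname{Im} z$,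
that of $T$ never does unless it is zero; hence $z$ is real. If $\operatorname{Re} z\ge0$, then
$\operatorname{Re} T\ge0$ while the right side has negative real part. -/
theorem neg_real_of_aeval_step_eq_zero (s : Multiset ℝ) (hs : ∀ a ∈ s, 0 < a) (z : ℂ)
    (hz : aeval z ((1 + ((s.card : ℝ[X]) + 1) * X) * (s.map fun a => X + C a).prod +
      X * (1 - X) * derivative (s.map fun a => X + C a).prod) = 0) :
    ∃ r : ℝ, r < 0 ∧ z = (r : ℂ) := by
  by_cases h : ∃ a ∈ s, z + (a : ℂ) = 0
  · obtain ⟨a, ha, hza⟩ := h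
    exact ⟨-a, by linarith [hs a ha], by push_cast; linear_combination hza⟩
  push Not at h
  have hne : aeval z (s.map fun a => X + C a).prod ≠ 0 := by
    rw [map_multiset_prod, Multiset.map_map]
    intro h0
    obtain ⟨a, ha, hza⟩ := Multiset.mem_map.1 (Multiset.prod_eq_zero_iff.1 h0)
    exact h a ha (by simpa using hza)
  simp only [map_add, map_mul, eval_derivative_prod s z h, map_one, map_natCast, aeval_X,
    map_sub] at hz
  set S := (s.map fun a : ℝ => (z + (a : ℂ))⁻¹).sum with hS
  have h1 : 1 + ((s.card : ℂ) + 1) * z + z * (1 - z) * S = 0 := by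
    apply mul_left_cancel₀ hne
    linear_combination hz
  have h0 : z ≠ 0 := by
    rintro rfl
    simp at h1
  have h2 := mobius_sum s z h
  have h3 := im_mul_mobius_sum_nonpos s hs z
  have h4 := re_mobius_sum_nonneg s hs z
  rw [← hS] at h2
  set T := (s.map fun a : ℝ => (1 + (a : ℂ)) * (z + (a : ℂ))⁻¹).sum
  have h5 : T = -1 - z⁻¹ := by
    rw [h2]
    field_simp
    linear_combination h1
  have hN := Complex.normSq_pos.2 h0
  have him : z.im = 0 := by
    rw [h5] at h3
    simp only [Complex.sub_im, Complex.neg_im, Complex.one_im, Complex.inv_im] at h3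
    by_contra hne
    have : 0 < z.im ^ 2 / Complex.normSq z := by positivity
    have e : z.im * (-0 - -z.im / Complex.normSq z) = z.im ^ 2 / Complex.normSq z := by ring
    linarith
  refine ⟨z.re, ?_, by apply Complex.ext <;> simp [him]⟩
  by_contra hre
  push Not at hre
  have h4 := h4 hre
  rw [h5] at h4
  simp only [Complex.sub_re, Complex.neg_re, Complex.one_re, Complex.inv_re] at h4
  have : 0 ≤ z.re / Complex.normSq z := by positivity
  linarith

theorem monic_natDegree_step {p : ℝ[X]} (hp : p.Monic) :
    ((1 + ((p.natDegree : ℝ[X]) + 1) * X) * p + X * (1 - X) * derivative p).Monic ∧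
    ((1 + ((p.natDegree : ℝ[X]) + 1) * X) * p + X * (1 - X) * derivative p).natDegree =
      p.natDegree + 1 := by
  set k := p.natDegree with hk
  set q := (1 + ((k : ℝ[X]) + 1) * X) * p + X * (1 - X) * derivative p with hq
  have hcoeff : q.coeff (k + 1) = 1 := by
    have e : q = p + C ((k : ℝ) + 1) * (p * X) + derivative p * X - derivative p * X * X := by
      rw [hq]; simp; ring
    have h1 : p.coeff (k + 1) = 0 := coeff_eq_zero_of_natDegree_lt (by omega)
    have h2 : p.coeff k = 1 := hp
    rcases Nat.eq_zero_or_pos k with h0 | h0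
    · have : p = 1 := hp.natDegree_eq_zero.1 (by omega)
      rw [e, this, h0]
      simp [coeff_one, coeff_X]
    · obtain ⟨m, hm⟩ : ∃ m, k = m + 1 := ⟨k - 1, by omega⟩
      have hc : q.coeff (k + 1) = p.coeff (k + 1) + (k + 1) * p.coeff k +
          (derivative p).coeff k - (derivative p).coeff m := by
        rw [e, coeff_sub, coeff_add, coeff_add, coeff_C_mul, coeff_mul_X, coeff_mul_X, hm,
          coeff_mul_X, coeff_mul_X]
      rw [hc, coeff_derivative, coeff_derivative, ← hm, h1, h2, hm]
      push_cast
      ring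
  have hle : q.natDegree ≤ k + 1 := by
    rw [hq]
    have hd := natDegree_derivative_le p
    have e : (1 + ((k : ℝ[X]) + 1) * X) = C ((k : ℝ) + 1) * X + C 1 := by simp; ring
    have e2 : (X * (1 - X) : ℝ[X]) = C (-1) * X ^ 2 + C 1 * X + C 0 := by simp; ring
    refine natDegree_add_le_of_degree_le ?_ ?_
    · refine natDegree_mul_le.trans ?_
      rw [e]
      have := natDegree_linear_le (a := (k : ℝ) + 1) (b := 1)
      omega
    -- For `k = 0` the truncated bound `k - 1` on the degree of the derivative is too weak; there
    -- the derivative vanishes.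
    · by_cases h0 : k = 0
      · have : p = 1 := hp.natDegree_eq_zero.1 (by omega)
        simp [this]
      refine natDegree_mul_le.trans ?_
      rw [e2]
      have := natDegree_quadratic_le (a := (-1 : ℝ)) (b := 1) (c := 0)
      omega
  exact ⟨monic_of_natDegree_le_of_coeff_eq_one _ hle hcoeff,
    le_antisymm hle (le_natDegree_of_ne_zero (by rw [hcoeff]; norm_num))⟩

theorem eulerian_eq_prod (k : ℕ) : ∃ s : Multiset ℝ, s.card = k ∧ (∀ a ∈ s, 0 < a) ∧
    eulerian k = (s.map fun a => X + C a).prod := by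
  induction k with
  | zero => exact ⟨0, by simp [eulerian]⟩
  | succ k ih =>
    obtain ⟨s, rfl, hpos, hs⟩ := ih
    have hm : (s.map fun a => X + C a).prod.Monic :=
      monic_multiset_prod_of_monic _ _ fun a _ => monic_X_add_C a
    have hd : (s.map fun a => X + C a).prod.natDegree = s.card := by
      rw [natDegree_multiset_prod_of_monic]
      · simp
      · intro f hf
        obtain ⟨a, -, rfl⟩ := Multiset.mem_map.1 hf
        exact monic_X_add_C a
    have := monic_natDegree_step hm
    rw [hd] at this
    rw [eulerian, hs]
    obtain ⟨t, ht, h⟩ := exists_pos_prod_of_roots _ this.1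
      (fun z hz => neg_real_of_aeval_step_eq_zero s hpos z hz)
    exact ⟨t, by rw [ht, this.2], h⟩


/-! ### Signed permutations correspond to their words -/

/-- The word `π(1) ⋯ π(n)`. -/
noncomputable def word {n : ℕ} (π : hyperoctahedral n) : List ℤ :=
  (List.range n).map fun i : ℕ => value π (i + 1)

theorem mem_PM_iff {n : ℕ} {i : ℤ} :
    i ∈ (Finset.Icc (-(n : ℤ)) (n : ℤ)).erase 0 ↔ 1 ≤ i.natAbs ∧ i.natAbs ≤ n := by
  simp only [Finset.mem_erase, Finset.mem_Icc]
  omega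

theorem value_eq {n : ℕ} (π : hyperoctahedral n) (i : PM n) :
    value π i.1 = ((π : Equiv.Perm (PM n)) i : ℤ) := by
  rw [value, dif_pos i.2]

theorem value_neg {n : ℕ} (π : hyperoctahedral n) (i : PM n) : value π (-i.1) = - value π i.1 := by
  have h := congrArg Subtype.val (π.2 i)
  rw [← value_eq] at h
  rw [value_eq π i]
  exact h

theorem natAbs_value {n : ℕ} (π : hyperoctahedral n) (i : PM n) :
    1 ≤ (value π i.1).natAbs ∧ (value π i.1).natAbs ≤ n := by
  rw [value_eq]
  exact mem_PM_iff.1 ((π : Equiv.Perm (PM n)) i).2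

theorem value_inj {n : ℕ} (π : hyperoctahedral n) {i j : PM n} (h : value π i.1 = value π j.1) :
    i = j := by
  rw [value_eq, value_eq] at h
  exact (π : Equiv.Perm (PM n)).injective (Subtype.ext h)

/-- The positive element `i + 1` of `±[n]`. -/
def PM.ofNat {n : ℕ} (i : ℕ) (hi : i < n) : PM n := ⟨(i : ℤ) + 1, mem_PM_iff.2 (by omega)⟩

theorem word_mem {n : ℕ} (π : hyperoctahedral n) : word π ∈ signedWords n := by
  rw [mem_signedWords, word, List.map_map]
  refine List.Subperm.perm_of_length_le (List.Nodup.subperm ?_ ?_) (by simp)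
  · refine List.Nodup.map_on ?_ List.nodup_range
    intro i hi j hj h
    rw [List.mem_range] at hi hj
    simp only [Function.comp] at h
    rcases Int.natAbs_eq_natAbs_iff.1 h with h | h
    · have := congrArg Subtype.val (value_inj π (i := PM.ofNat i hi) (j := PM.ofNat j hj) h)
      simp only [PM.ofNat] at this
      omega
    -- Here $\pi(i)=-\pi(j)=\pi(-j)$ for positive positions, which injectivity rules out.
    · have h' := value_neg π (PM.ofNat j hj)
      have := congrArg Subtype.val (value_inj π (i := PM.ofNat i hi) (j := (PM.ofNat j hj).neg)
        (h.trans h'.symm))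
      simp only [PM.ofNat, PM.neg] at this
      omega
  · intro a ha
    obtain ⟨i, hi, rfl⟩ := List.mem_map.1 ha
    have := natAbs_value π (PM.ofNat i (List.mem_range.1 hi))
    simp only [PM.ofNat] at this
    simp only [List.mem_range'_1, Function.comp]
    omega

theorem PM.cases {n : ℕ} (i : PM n) :
    ∃ (k : ℕ) (hk : k < n), i = PM.ofNat k hk ∨ i = (PM.ofNat k hk).neg := by
  have h := mem_PM_iff.1 i.2
  refine ⟨i.1.natAbs - 1, by omega, ?_⟩
  simp only [PM.ofNat, PM.neg, Subtype.ext_iff]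
  omega

theorem word_injective {n : ℕ} : Function.Injective (word (n := n)) := by
  intro π σ h
  have hv : ∀ k (hk : k < n), value π ((k : ℤ) + 1) = value σ ((k : ℤ) + 1) := by
    intro k hk
    exact List.map_inj_left.1 h k (List.mem_range.2 hk)
  apply Subtype.ext
  apply Equiv.ext
  intro i
  apply Subtype.ext
  rw [← value_eq, ← value_eq]
  obtain ⟨k, hk, rfl | rfl⟩ := i.cases
  · exact hv k hk
  · exact (value_neg π (PM.ofNat k hk)).trans
      ((congrArg Neg.neg (hv k hk)).trans (value_neg σ (PM.ofNat k hk)).symm)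

theorem exists_word_eq {n : ℕ} {l : List ℤ} (hl : l ∈ signedWords n) :
    ∃ π : hyperoctahedral n, word π = l := by
  have hlen := length_of_mem_signedWords hl
  have hnd : (l.map Int.natAbs).Nodup := (mem_signedWords.1 hl).nodup_iff.2 List.nodup_range'
  -- The odd extension of the word; the default `0` is never read on `±[n]`.
  let g : ℤ → ℤ := fun i => i.sign * l.getD (i.natAbs - 1) 0
  have hval : ∀ i : PM n, ∃ h : i.1.natAbs - 1 < l.length, g i.1 = i.1.sign * l[i.1.natAbs - 1] ∧
      (g i.1).natAbs = l[i.1.natAbs - 1].natAbs := by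
    intro i
    have hi := mem_PM_iff.1 i.2
    have hlt : i.1.natAbs - 1 < l.length := by omega
    have e : g i.1 = i.1.sign * l[i.1.natAbs - 1] := by
      simp only [g, List.getD_eq_getElem _ _ hlt]
    refine ⟨hlt, e, ?_⟩
    rw [e, Int.natAbs_mul, Int.natAbs_sign_of_ne_zero (by omega), one_mul]
  have hmem : ∀ i : PM n, g i.1 ∈ (Finset.Icc (-(n : ℤ)) (n : ℤ)).erase 0 := by
    intro i
    obtain ⟨h, -, h2⟩ := hval i
    rw [mem_PM_iff, h2]
    exact natAbs_of_mem_signedWords hl (List.getElem_mem h)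
  let f : PM n → PM n := fun i => ⟨g i.1, hmem i⟩
  have hinj : Function.Injective f := by
    intro i j hij
    have hij : g i.1 = g j.1 := congrArg Subtype.val hij
    have hi := mem_PM_iff.1 i.2
    have hj := mem_PM_iff.1 j.2
    obtain ⟨h1, h2, h3⟩ := hval i
    obtain ⟨h4, h5, h6⟩ := hval j
    have hidx : i.1.natAbs - 1 = j.1.natAbs - 1 := by
      refine (List.Nodup.getElem_inj_iff hnd (hi := by simpa using h1) (hj := by simpa using h4)).1 ?_
      simp only [List.getElem_map]
      rw [← h3, ← h6, hij]
    have hne : l[j.1.natAbs - 1] ≠ 0 := by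
      have := natAbs_of_mem_signedWords hl (List.getElem_mem h4)
      omega
    rw [h2, h5] at hij
    simp only [hidx] at hij
    have hs := mul_right_cancel₀ hne hij
    apply Subtype.ext
    rw [← Int.sign_mul_natAbs i.1, ← Int.sign_mul_natAbs j.1, hs]
    congr 2
    omega
  let π : Equiv.Perm (PM n) := Equiv.ofBijective f (Finite.injective_iff_bijective.1 hinj)
  have hπ : π ∈ hyperoctahedral n := by
    intro i
    apply Subtype.ext
    change g (-i.1) = -g i.1
    simp [g, Int.sign_neg]
  refine ⟨⟨π, hπ⟩, List.ext_getElem (by simp [word, hlen]) fun k h1 h2 => ?_⟩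
  have h := value_eq ⟨π, hπ⟩ (PM.ofNat k (hlen ▸ h2))
  simp only [word, List.getElem_map, List.getElem_range]
  refine h.trans ?_
  change g ((k : ℤ) + 1) = _
  have e : ((k : ℤ) + 1).natAbs - 1 = k := by omega
  simp only [g, e, List.getD_eq_getElem _ _ h2]
  rw [Int.sign_eq_one_of_pos (by omega), one_mul]

theorem desA_eq {n : ℕ} (π : hyperoctahedral n) : desA π = des (word π) := by
  cases n with
  | zero => simp [desA, word, des]
  | succ m =>
    rw [word, des_map_range, desA]
    symm
    refine Finset.card_bij (fun i _ => (i : ℤ) + 1) ?_ ?_ ?_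
    · intro i hi
      simp only [Finset.mem_filter, Finset.mem_range, Finset.mem_Icc] at hi ⊢
      push_cast at hi ⊢
      exact ⟨by omega, hi.2⟩
    · intro i _ j _ h
      exact_mod_cast add_right_cancel h
    · intro j hj
      simp only [Finset.mem_filter, Finset.mem_Icc] at hj
      have e : (((j - 1).toNat : ℕ) : ℤ) = j - 1 := by omega
      refine ⟨(j - 1).toNat, ?_, by omega⟩
      simp only [Finset.mem_filter, Finset.mem_range]
      push_cast
      rw [e, sub_add_cancel]
      exact ⟨by push_cast at hj; omega, hj.2⟩

theorem value_one_eq {n : ℕ} (π : hyperoctahedral n) : value π 1 = (word π).headI := by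
  cases n with
  -- Both sides are the default value `0`.
  | zero => simp [value, word]
  | succ m => simp [word, List.range_succ_eq_map]

theorem sum_hyperoctahedral {M : Type*} [AddCommMonoid M] {n : ℕ} (g : List ℤ → M) :
    ∑ π : hyperoctahedral n, g (word π) = ∑ l ∈ signedWords n, g l :=
  Finset.sum_bij (fun π _ => word π) (fun π _ => word_mem π) (fun _ _ _ _ h => word_injective h)
    (fun _ hl => (exists_word_eq hl).imp fun π h => ⟨Finset.mem_univ π, h⟩) (fun _ _ => rfl)

/-! ### Recurrences for the even and odd parts -/

/-- The polynomial `1` for positive integers and `0` for all others. -/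
noncomputable def posIndicator (a : ℤ) : ℝ[X] := if 0 < a then 1 else 0

theorem posIndicator_of_pos {a : ℤ} (h : 0 < a) : posIndicator a = 1 := if_pos h

theorem posIndicator_of_neg {a : ℤ} (h : a < 0) : posIndicator a = 0 := if_neg h.not_gt

theorem CE_eq_sum (n : ℕ) :
    CE n = ∑ l ∈ signedWords n, posIndicator l.headI * X ^ des l := by
  rw [CE, Finset.sum_filter, ← sum_hyperoctahedral]
  simp only [value_one_eq, desA_eq, posIndicator, ite_mul, one_mul, zero_mul]

theorem CO_eq_sum (n : ℕ) :
    CO n = ∑ l ∈ signedWords n, posIndicator (-l.headI) * X ^ des l := by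
  rw [CO, Finset.sum_filter, ← sum_hyperoctahedral]
  simp only [value_one_eq, desA_eq, posIndicator, ite_mul, one_mul, zero_mul, neg_pos]

theorem des_front_large {a b : ℤ} (l : List ℤ) (h : b < a) :
    des (a :: b :: l) = des (b :: l) + 1 := by
  simp [des, h, add_comm]

theorem des_front_small {a b : ℤ} (l : List ℤ) (h : a < b) : des (a :: b :: l) = des (b :: l) := by
  simp [des, h.le]

/-- Turns the factors `des` produced by counting insertions into the derivative term of the
recurrences. -/
theorem derivative_X_pow_identity (d : ℕ) :
    2 * X * (1 - X) * derivative (X ^ d : ℝ[X]) =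
      2 * (d : ℝ[X]) * X ^ d - 2 * (d : ℝ[X]) * X ^ (d + 1) := by
  cases d with
  | zero => simp
  | succ d =>
    rw [derivative_X_pow]
    simp only [C_eq_natCast, Nat.add_sub_cancel]
    ring

/-- The contribution of the insertions of `±(n + 1)` into one word of length `n`. -/
theorem sum_insert_signed {n : ℕ} {b : ℤ} {l : List ℤ} (h : b :: l ∈ signedWords n) :
    ∑ k ∈ Finset.range n, ((X : ℝ[X]) ^ des ((b :: l).insertIdx (k + 1) (n + 1)) +
        X ^ des ((b :: l).insertIdx (k + 1) (-(n + 1)))) =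
      (1 + 2 * (des (b :: l) : ℝ[X])) * X ^ des (b :: l) +
        (2 * (n : ℝ[X]) - 1 - 2 * (des (b :: l) : ℝ[X])) * X ^ (des (b :: l) + 1) := by
  have hlen : l.length + 1 = n := length_of_mem_signedWords h
  have hb : ∀ c ∈ b :: l, c.natAbs ≤ n := fun c hc => (natAbs_of_mem_signedWords h hc).2
  rw [Finset.sum_add_distrib]
  have h1 := sum_insert_large (n + 1) b l fun c hc => by have := hb c hc; omega
  have h2 := sum_insert_small (-(n + 1)) b l fun c hc => by have := hb c hc; omega
  rw [hlen] at h1 h2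
  rw [h1, h2, ← hlen]
  push_cast
  ring

theorem exists_cons_of_mem {n : ℕ} (hn : 1 ≤ n) {w : List ℤ} (hw : w ∈ signedWords n) :
    ∃ b l, w = b :: l ∧ b ≠ 0 ∧ b < n + 1 ∧ -(n + 1 : ℤ) < b := by
  have hlen := length_of_mem_signedWords hw
  cases w with
  | nil => simp at hlen; omega
  | cons b l =>
    have := natAbs_of_mem_signedWords hw (List.mem_cons_self (a := b) (l := l))
    exact ⟨b, l, rfl, by omega, by omega, by omega⟩

/-- The identity holds word by word. In front, only `n + 1` gives a positive first letter, at the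
cost of one descent. This yields the term `X * CO n` from words with negative first letter and
raises $2n-1$ to $2n$ for the others. -/
theorem CE_succ {n : ℕ} (hn : 1 ≤ n) :
    CE (n + 1) = (2 * (n : ℝ[X]) * X + 1) * CE n
      + 2 * X * (1 - X) * derivative (CE n) + X * CO n := by
  rw [CE_eq_sum, CE_eq_sum, CO_eq_sum, sum_signedWords_succ, derivative_sum, Finset.mul_sum,
    Finset.mul_sum, Finset.mul_sum, ← Finset.sum_add_distrib, ← Finset.sum_add_distrib]
  refine Finset.sum_congr rfl fun w hw => ?_
  obtain ⟨b, l, rfl, hb0, hb1, hb2⟩ := exists_cons_of_mem hn hw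
  have hS := sum_insert_signed hw
  have hd := derivative_X_pow_identity (des (b :: l))
  rw [Finset.sum_range_succ']
  simp only [List.insertIdx_succ_cons, List.insertIdx_zero, List.headI_cons] at hS ⊢
  rw [posIndicator_of_pos (by omega : (0 : ℤ) < n + 1),
    posIndicator_of_neg (by omega : -(n + 1 : ℤ) < 0), des_front_large l hb1]
  rcases lt_or_gt_of_ne hb0 with hb | hb
  · simp only [posIndicator_of_neg hb, posIndicator_of_pos (neg_pos.2 hb)]
    simp
    ring
  · simp only [posIndicator_of_pos hb, posIndicator_of_neg (neg_lt_zero.2 hb), one_mul, zero_mul]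
    rw [hS, hd]
    ring

/-- In front, only `-(n + 1)` counts, and it creates no descent: hence the term `CE n` and the
constant $2$ in place of $1$. -/
theorem CO_succ {n : ℕ} (hn : 1 ≤ n) :
    CO (n + 1) = ((2 * (n : ℝ[X]) - 1) * X + 2) * CO n
      + 2 * X * (1 - X) * derivative (CO n) + CE n := by
  rw [CO_eq_sum, CO_eq_sum, CE_eq_sum, sum_signedWords_succ, derivative_sum, Finset.mul_sum,
    Finset.mul_sum, ← Finset.sum_add_distrib, ← Finset.sum_add_distrib]
  refine Finset.sum_congr rfl fun w hw => ?_
  obtain ⟨b, l, rfl, hb0, hb1, hb2⟩ := exists_cons_of_mem hn hw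
  have hS := sum_insert_signed hw
  have hd := derivative_X_pow_identity (des (b :: l))
  rw [Finset.sum_range_succ']
  simp only [List.insertIdx_succ_cons, List.insertIdx_zero, List.headI_cons] at hS ⊢
  rw [posIndicator_of_neg (by omega : -(n + 1 : ℤ) < 0), neg_neg,
    posIndicator_of_pos (by omega : (0 : ℤ) < n + 1), des_front_small l hb2]
  rcases lt_or_gt_of_ne hb0 with hb | hb
  · simp only [posIndicator_of_neg hb, posIndicator_of_pos (neg_pos.2 hb), one_mul, zero_mul]
    rw [hS, hd]
    ring
  · simp only [posIndicator_of_pos hb, posIndicator_of_neg (neg_lt_zero.2 hb)]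
    simp

theorem signedWords_one : signedWords 1 = {[1], [-1]} := by
  decide

theorem CE_one : CE 1 = 1 := by
  rw [CE_eq_sum, signedWords_one, Finset.sum_pair (by decide)]
  simp [des, posIndicator]

theorem CO_one : CO 1 = 1 := by
  rw [CO_eq_sum, signedWords_one, Finset.sum_pair (by decide)]
  simp [des, posIndicator]

theorem flagDescentPoly_eq {n : ℕ} (hn : 1 ≤ n) :
    flagDescentPoly n = (CE n).comp (X ^ 2) + X * (CO n).comp (X ^ 2) := by
  rw [flagDescentPoly, CE, CO, Finset.sum_filter, Finset.sum_filter, sum_comp,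
    sum_comp, Finset.mul_sum, ← Finset.sum_add_distrib]
  refine Finset.sum_congr rfl fun π _ => ?_
  have h := (natAbs_value π (PM.ofNat 0 hn)).1
  simp only [PM.ofNat, Nat.cast_zero, zero_add] at h
  rw [fdes]
  rcases lt_or_gt_of_ne (by omega : value π 1 ≠ 0) with hb | hb
  · simp only [if_neg hb.not_gt, if_pos hb]
    simp [pow_succ, pow_mul]
    ring
  · simp only [if_neg hb.not_gt, if_pos hb]
    simp [pow_mul]

theorem desA_le {n : ℕ} (π : hyperoctahedral n) : desA π ≤ n - 1 := by
  refine (Finset.card_filter_le _ _).trans ?_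
  rw [Int.card_Icc]
  omega

/-- Upper bounds suffice: `n - 1` distinct zeros are exhibited later. -/
theorem natDegree_CE_le (n : ℕ) : (CE n).natDegree ≤ n - 1 :=
  natDegree_sum_le_of_forall_le _ _ fun π _ => by simpa using desA_le π

theorem natDegree_CO_le (n : ℕ) : (CO n).natDegree ≤ n - 1 :=
  natDegree_sum_le_of_forall_le _ _ fun π _ => by simpa using desA_le π


/-! ### Factorization of the flag descent polynomial -/

theorem flagDescentPoly_succ {n : ℕ} (hn : 1 ≤ n) :
    flagDescentPoly (n + 1) = (1 + X + 2 * (n : ℝ[X]) * X ^ 2) * flagDescentPoly n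
      + X * (1 - X ^ 2) * derivative (flagDescentPoly n) := by
  rw [flagDescentPoly_eq hn, flagDescentPoly_eq (by omega : 1 ≤ n + 1), CE_succ hn, CO_succ hn]
  simp only [derivative_add, derivative_mul, derivative_comp, derivative_X, derivative_X_sq,
    add_comp, mul_comp, sub_comp, natCast_comp, X_comp, one_comp, ofNat_comp, C_ofNat]
  ring

/-- With $n=k+1$, differentiating $(1+x)^n$ contributes $nx(1-x)$ to the coefficient of $(1+x)^nA$,
and $1+x+2nx^2+nx(1-x)=(1+x)(1+nx)$ leaves the Eulerian recurrence. -/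
theorem flagDescentPoly_eq_eulerian (k : ℕ) :
    flagDescentPoly (k + 1) = (1 + X) ^ (k + 1) * eulerian k := by
  induction k with
  | zero => rw [flagDescentPoly_eq le_rfl, CE_one, CO_one]; simp [eulerian]
  | succ k ih =>
    rw [flagDescentPoly_succ (by omega), ih, eulerian]
    simp only [derivative_mul, derivative_pow, derivative_add, derivative_one, derivative_X,
      Nat.add_sub_cancel, C_eq_natCast]
    push_cast
    ring

theorem flagDescentPoly_eq_prod (k : ℕ) : ∃ s : Multiset ℝ, s.card = 2 * k + 1 ∧
    (∀ a ∈ s, 0 < a) ∧ flagDescentPoly (k + 1) = (s.map fun a => X + C a).prod := by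
  obtain ⟨s, hs, hpos, h⟩ := eulerian_eq_prod k
  refine ⟨Multiset.replicate (k + 1) 1 + s, by simp [hs]; omega, ?_, ?_⟩
  · intro a ha
    rcases Multiset.mem_add.1 ha with ha | ha
    · rw [Multiset.eq_of_mem_replicate ha]; exact one_pos
    · exact hpos a ha
  · rw [flagDescentPoly_eq_eulerian, h]
    simp only [Multiset.map_add, Multiset.map_replicate, Multiset.prod_add,
      Multiset.prod_replicate, C_1, add_comm]

/-! ### Hermite–Biehler by the argument on the imaginary axis -/

/-- The argument of `∏ (a + i y)`. -/
noncomputable def phase (s : Multiset ℝ) (y : ℝ) : ℝ := (s.map fun a => Real.arctan (y / a)).sum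

theorem phase_cons (a : ℝ) (s : Multiset ℝ) (y : ℝ) :
    phase (a ::ₘ s) y = Real.arctan (y / a) + phase s y := by simp [phase]

theorem phase_apply_zero (s : Multiset ℝ) : phase s 0 = 0 := by simp [phase]

theorem continuous_phase (s : Multiset ℝ) : Continuous (phase s) := by
  induction s using Multiset.induction with
  | empty => exact continuous_const (y := (0 : ℝ))
  | cons a s ih =>
    simp only [funext (phase_cons a s)]
    exact (Real.continuous_arctan.comp (continuous_id.div_const a)).add ih

theorem monotone_phase (s : Multiset ℝ) (hs : ∀ a ∈ s, 0 < a) : Monotone (phase s) := by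
  induction s using Multiset.induction with
  | empty => intro x y _; simp [phase]
  | cons a s ih =>
    simp only [funext (phase_cons a s)]
    refine Monotone.add (fun x y h => Real.arctan_strictMono.monotone ?_)
      (ih fun b hb => hs b (by simp [hb]))
    have := hs a (by simp)
    gcongr

theorem tendsto_phase (s : Multiset ℝ) (hs : ∀ a ∈ s, 0 < a) :
    Filter.Tendsto (phase s) Filter.atTop (nhds (s.card * (Real.pi / 2))) := by
  induction s using Multiset.induction with
  | empty =>
    have : phase 0 = fun _ => 0 := by funext y; simp [phase]
    simp [this]
  | cons a s ih =>
    simp only [funext (phase_cons a s), Multiset.card_cons, Nat.cast_add, Nat.cast_one]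
    rw [add_mul, one_mul, add_comm]
    refine Filter.Tendsto.add ?_ (ih fun b hb => hs b (by simp [hb]))
    exact (Real.tendsto_arctan_atTop.mono_right nhdsWithin_le_nhds).comp
      (Filter.tendsto_id.atTop_div_const (hs a (by simp)))

theorem exists_phase_eq (s : Multiset ℝ) (hs : ∀ a ∈ s, 0 < a) {t : ℝ} (h0 : 0 < t)
    (h1 : t < s.card * (Real.pi / 2)) : ∃ y, 0 < y ∧ phase s y = t := by
  obtain ⟨Y, hY⟩ := ((tendsto_phase s hs).eventually_const_lt h1).exists
  have hY0 : 0 < Y := by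
    by_contra h
    have := monotone_phase s hs (not_lt.1 h)
    rw [phase_apply_zero] at this
    linarith
  obtain ⟨y, hy, hyt⟩ := intermediate_value_Icc hY0.le (continuous_phase s).continuousOn
    (show t ∈ Set.Icc _ _ from ⟨by rw [phase_apply_zero]; exact h0.le, hY.le⟩)
  refine ⟨y, hy.1.lt_of_ne ?_, hyt⟩
  rintro rfl
  rw [phase_apply_zero] at hyt
  exact h0.ne hyt

/-- Each factor is $a+iy=\frac{a}{\cos\theta}(\cos\theta+i\sin\theta)$ with $\theta=\arctan(y/a)$,
and the angles add. -/
theorem aeval_prod_eq_polar (s : Multiset ℝ) (hs : ∀ a ∈ s, 0 < a) (y : ℝ) :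
    ∃ R : ℝ, 0 < R ∧ aeval (y * Complex.I) (s.map fun a => X + C a).prod =
      R * (Real.cos (phase s y) + Real.sin (phase s y) * Complex.I) := by
  induction s using Multiset.induction with
  | empty => exact ⟨1, one_pos, by simp [phase]⟩
  | cons a s ih =>
    obtain ⟨R, hR, h⟩ := ih fun b hb => hs b (by simp [hb])
    have ha := hs a (by simp)
    have hc := Real.cos_arctan_pos (y / a)
    refine ⟨a / Real.cos (Real.arctan (y / a)) * R, by positivity, ?_⟩
    have ht : Real.sin (Real.arctan (y / a)) * a = y * Real.cos (Real.arctan (y / a)) := by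
      have := Real.tan_arctan (y / a)
      rw [Real.tan_eq_sin_div_cos] at this
      field_simp at this
      linarith
    rw [Multiset.map_cons, Multiset.prod_cons, map_mul, h, phase_cons, Real.cos_add, Real.sin_add]
    set c := Real.cos (Real.arctan (y / a))
    set d := Real.sin (Real.arctan (y / a))
    set u := Real.cos (phase s y)
    set v := Real.sin (phase s y)
    have hc' : (c : ℂ) ≠ 0 := by exact_mod_cast hc.ne'
    have ht' : (d : ℂ) * a = y * c := by exact_mod_cast ht
    simp only [map_add, aeval_X, aeval_C, Complex.coe_algebraMap]
    push_cast
    field_simp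
    linear_combination (-Complex.I * R * (u + v * Complex.I)) * ht' +
      (R * d * a * v : ℂ) * Complex.I_sq

theorem eval_neg_sq_eq (p q : ℝ[X]) (s : Multiset ℝ) (hs : ∀ a ∈ s, 0 < a)
    (h : p.comp (X ^ 2) + X * q.comp (X ^ 2) = (s.map fun a => X + C a).prod) (y : ℝ) :
    ∃ R : ℝ, 0 < R ∧ p.eval (-y ^ 2) = R * Real.cos (phase s y) ∧
      y * q.eval (-y ^ 2) = R * Real.sin (phase s y) := by
  obtain ⟨R, hR, e⟩ := aeval_prod_eq_polar s hs y
  have key : ∀ r : ℝ[X], aeval (y * Complex.I) (r.comp (X ^ 2)) = ((r.eval (-y ^ 2) : ℝ) : ℂ) := by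
    intro r
    rw [aeval_comp]
    have : aeval (y * Complex.I) (X ^ 2 : ℝ[X]) = ((-y ^ 2 : ℝ) : ℂ) := by
      simp [mul_pow]
    rw [this]
    exact aeval_algebraMap_apply ℂ (-y ^ 2) r
  rw [← h, map_add, map_mul, key, key, aeval_X] at e
  refine ⟨R, hR, ?_, ?_⟩
  · simpa [-Complex.ofReal_cos, -Complex.ofReal_sin] using congrArg Complex.re e
  · simpa [-Complex.ofReal_cos, -Complex.ofReal_sin] using congrArg Complex.im e

/-- Distinct zeros as numerous as the degree bound exhaust the root multiset. -/
theorem hasZeros_of_strictMono {k : ℕ} {p : ℝ[X]} (hp : p ≠ 0) (hd : p.natDegree ≤ k)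
    {ξ : Fin k → ℝ} (hξ : StrictMono ξ) (h : ∀ i, p.eval (ξ i) = 0) : HasZeros p ξ := by
  refine ⟨hp, hξ.monotone, ?_⟩
  have hnd : (Finset.univ.val.map ξ).Nodup := Finset.univ.nodup.map hξ.injective
  have hle : Finset.univ.val.map ξ ≤ p.roots := by
    rw [Multiset.le_iff_subset hnd]
    intro x hx
    obtain ⟨i, -, rfl⟩ := Multiset.mem_map.1 hx
    exact (mem_roots hp).2 (h i)
  have hcard : (Finset.univ.val.map ξ).card = k := by simp
  have heq := Multiset.eq_of_le_of_card_le hle (by have := p.card_roots'; omega)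
  have hr : p.roots.card = p.natDegree :=
    le_antisymm p.card_roots' (by rw [← heq, hcard]; exact hd)
  conv_lhs => rw [← C_leadingCoeff_mul_prod_multiset_X_sub_C hr, ← heq, Multiset.map_map]
  rfl

theorem HasZeros.onlyRealNegativeZeros {k : ℕ} {p : ℝ[X]} {ξ : Fin k → ℝ} (h : HasZeros p ξ)
    (hneg : ∀ i, ξ i < 0) : OnlyRealNegativeZeros p := by
  intro z hz
  rw [h.2.2, map_mul, map_prod, aeval_C, mul_eq_zero, Finset.prod_eq_zero_iff] at hz
  rcases hz with hz | ⟨i, -, hz⟩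
  · exact absurd hz (by simpa using h.1)
  · exact ⟨ξ i, hneg i, by simpa [sub_eq_zero] using hz⟩

/-- A form of the Hermite–Biehler theorem: if `p(x²) + x q(x²)` has only negative zeros, then `p`
and `q` have only negative zeros and these interlace. -/
theorem interlacing_of_even_odd {k : ℕ} {p q : ℝ[X]} (hp : p.natDegree ≤ k) (hq : q.natDegree ≤ k)
    {s : Multiset ℝ} (hs : ∀ a ∈ s, 0 < a) (hcard : s.card = 2 * k + 1)
    (h : p.comp (X ^ 2) + X * q.comp (X ^ 2) = (s.map fun a => X + C a).prod) :
    OnlyRealNegativeZeros p ∧ OnlyRealNegativeZeros q ∧ AlternatesLeft q p := by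
  have hπ := Real.pi_pos
  have hpolar := eval_neg_sq_eq p q s hs h
  -- Stated for every `t`, with an irrelevant `y` outside the range of the phase, so that `choose`
  -- gives a function of `t` alone.
  have hex : ∀ t : ℝ, ∃ y, 0 < t → t < (2 * k + 1) * (Real.pi / 2) → 0 < y ∧ phase s y = t := by
    intro t
    by_cases ht : 0 < t ∧ t < (2 * k + 1) * (Real.pi / 2)
    · obtain ⟨y, hy⟩ := exists_phase_eq s hs ht.1 (by rw [hcard]; push_cast; exact ht.2)
      exact ⟨y, fun _ _ => hy⟩
    · exact ⟨0, fun h1 h2 => absurd ⟨h1, h2⟩ ht⟩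
  choose y hy using hex
  have hlt : ∀ t u, 0 < t → t < u → u < (2 * k + 1) * (Real.pi / 2) → -y u ^ 2 < -y t ^ 2 := by
    intro t u h1 h2 h3
    obtain ⟨ht, ht'⟩ := hy t h1 (h2.trans h3)
    obtain ⟨hu, hu'⟩ := hy u (h1.trans h2) h3
    have : y t < y u := (monotone_phase s hs).reflect_lt (by rw [ht', hu']; exact h2)
    nlinarith
  have hk0 : (0 : ℝ) ≤ k := k.cast_nonneg
  have hne : p ≠ 0 ∧ q ≠ 0 := by
    -- The phase $\pi/4$ is attained even for `k = 0`, and there neither sine nor cosine vanishes.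
    obtain ⟨h1, h2⟩ := hy (Real.pi / 4) (by positivity) (by nlinarith)
    obtain ⟨R, hR, e1, e2⟩ := hpolar (y (Real.pi / 4))
    rw [h2] at e1 e2
    rw [Real.cos_pi_div_four] at e1
    rw [Real.sin_pi_div_four] at e2
    have : 0 < R * (√2 / 2) := by positivity
    constructor
    · rintro rfl
      simp only [eval_zero] at e1
      linarith
    · rintro rfl
      simp only [eval_zero, mul_zero] at e2
      linarith
  have hi : ∀ i : Fin k, (i : ℝ) + 1 ≤ k := fun i => by exact_mod_cast i.2
  have hi0 : ∀ i : Fin k, (0 : ℝ) ≤ (i : ℝ) := fun i => Nat.cast_nonneg _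
  -- Phases of the zeros of `q` (`t`) and of `p` (`u`). They decrease in `i` because $-y^2$
  -- decreases as the phase grows, while the zeros must be listed in increasing order.
  let t : Fin k → ℝ := fun i => (k - i) * Real.pi
  let u : Fin k → ℝ := fun i => (k - i) * Real.pi - Real.pi / 2
  have ht : ∀ i, 0 < t i ∧ t i < (2 * k + 1) * (Real.pi / 2) := fun i => by
    have := hi i
    have := hi0 i
    constructor <;> simp only [t] <;> nlinarith
  have hu : ∀ i, 0 < u i ∧ u i < t i := fun i => by
    have := hi i
    constructor <;> simp only [t, u] <;> nlinarith
  have hu' : ∀ i, u i < (2 * k + 1) * (Real.pi / 2) := fun i => (hu i).2.trans (ht i).2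
  have hstep : ∀ i j : Fin k, (i : ℕ) < j → t j < u i := fun i j hij => by
    have : (i : ℝ) + 1 ≤ j := by exact_mod_cast hij
    simp only [t, u]
    nlinarith
  have hξ : StrictMono fun i => -y (t i) ^ 2 := fun i j hij =>
    hlt _ _ (ht j).1 ((hstep i j hij).trans (hu i).2) (ht i).2
  have hθ : StrictMono fun i => -y (u i) ^ 2 := fun i j hij =>
    hlt _ _ (hu j).1 ((hu j).2.trans (hstep i j hij)) (hu' i)
  have hqz : HasZeros q fun i => -y (t i) ^ 2 := by
    refine hasZeros_of_strictMono hne.2 hq hξ fun i => ?_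
    obtain ⟨h1, h2⟩ := hy (t i) (ht i).1 (ht i).2
    obtain ⟨R, hR, -, e⟩ := hpolar (y (t i))
    have : Real.sin (t i) = 0 := by
      have := Real.sin_nat_mul_pi (k - i)
      rwa [Nat.cast_sub i.2.le] at this
    rw [h2, this, mul_zero] at e
    exact (mul_eq_zero.1 e).resolve_left h1.ne'
  have hpz : HasZeros p fun i => -y (u i) ^ 2 := by
    refine hasZeros_of_strictMono hne.1 hp hθ fun i => ?_
    obtain ⟨h1, h2⟩ := hy (u i) (hu i).1 (hu' i)
    obtain ⟨R, hR, e, -⟩ := hpolar (y (u i))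
    have : Real.cos (u i) = 0 := by
      have := Real.sin_nat_mul_pi (k - i)
      rw [Nat.cast_sub i.2.le] at this
      rw [← this]
      exact Real.cos_sub_pi_div_two _
    rw [e, h2, this, mul_zero]
  refine ⟨hpz.onlyRealNegativeZeros fun i => ?_, hqz.onlyRealNegativeZeros fun i => ?_,
    k, _, _, hqz, hpz, fun i => (hlt _ _ (hu i).1 (hu i).2 (ht i).2).le,
    fun i j hij => (hlt _ _ (ht j).1 (hstep i j (by omega)) (hu' i)).le⟩
  · have := (hy (u i) (hu i).1 (hu' i)).1
    exact neg_lt_zero.2 (pow_pos this 2)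
  · have := (hy (t i) (ht i).1 (ht i).2).1
    exact neg_lt_zero.2 (pow_pos this 2)

end FlagDescent

theorem theorem2 :
    FlagDescent.CE 1 = 1 ∧ FlagDescent.CO 1 = 1 ∧
    ∀ n : ℕ, 1 ≤ n →
      FlagDescent.flagDescentPoly n =
        (FlagDescent.CE n).comp (X ^ 2) + X * (FlagDescent.CO n).comp (X ^ 2) ∧
      FlagDescent.CE (n + 1) =
        (2 * (n : ℝ[X]) * X + 1) * FlagDescent.CE n
          + 2 * X * (1 - X) * derivative (FlagDescent.CE n) + X * FlagDescent.CO n ∧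
      FlagDescent.CO (n + 1) =
        ((2 * (n : ℝ[X]) - 1) * X + 2) * FlagDescent.CO n
          + 2 * X * (1 - X) * derivative (FlagDescent.CO n) + FlagDescent.CE n ∧
      FlagDescent.OnlyRealNegativeZeros (FlagDescent.CE n) ∧
      FlagDescent.OnlyRealNegativeZeros (FlagDescent.CO n) ∧
      FlagDescent.Prec (FlagDescent.CO n) (FlagDescent.CE n) := by
  refine ⟨FlagDescent.CE_one, FlagDescent.CO_one, fun n hn =>
    ⟨FlagDescent.flagDescentPoly_eq hn, FlagDescent.CE_succ hn, FlagDescent.CO_succ hn, ?_⟩⟩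
  obtain ⟨k, rfl⟩ : ∃ k, n = k + 1 := ⟨n - 1, by omega⟩
  obtain ⟨s, hcard, hs, h⟩ := FlagDescent.flagDescentPoly_eq_prod k
  rw [FlagDescent.flagDescentPoly_eq hn] at h
  obtain ⟨h1, h2, h3⟩ := FlagDescent.interlacing_of_even_odd
    (FlagDescent.natDegree_CE_le (k + 1)) (FlagDescent.natDegree_CO_le (k + 1)) hs hcard h
  exact ⟨h1, h2, Or.inr h3⟩
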